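/- Let $D\ge 2$, $L\ge 0$, $K\ge 0$ be integers, $\mu\in[0,1)$, $b\in\mathbb R$, $c_1,\dots,c_K\in\mathbb R$, and let $\omega_0,\omega_1,\dots,\omega_K$ be real functions on the ages. A single source has $L$ on/off channels of success probability $\mu$, and its age $A[t]\in\{1,\dots,D\}$ is truncated at $D$: if $l\in\{0,\dots,L\}$ channels are used in slot $t$, then $A[t+1]=1$ with probability $1-(1-\mu)^l$ and $A[t+1]=\min(A[t]+1,D)$ with probability $(1-\mu)^l$. Let the number $u[t]\in\{0,\dots,L\}$ of channels used in slot $t$ be chosen by a randomized policy that may depend on the past ages and actions and on the current age. The policy is stationary if, at every time, it chooses $l$ channels at age $a$ with a fixed probability $f_a^l$. The initial age has an arbitrary law. Consider the constrained Markov decision problem $$\min\ \lim_{T\to\infty}\frac1T\sum_{t=1}^T\mathbb E[\omega_0(A[t])]\quad\text{s.t.}\quad \lim_{T\to\infty}\frac1T\sum_{t=1}^T\mathbb E[u[t]]\le b,\qquad \lim_{T\to\infty}\frac1T\sum_{t=1}^T\mathbb E[\omega_k(A[t])]\le c_k\quad(1\le k\le K),\tag{1}$$ where each $\lim$ is read as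 $\limsup$ if the limit does not exist, and the linear program in the variables $y_a^l$, $1\le a\le D$, $0\le l\le L$, $$\min\ \sum_{a,l}y_a^l\,\omega_0(a)\quad\text{s.t.}\quad \sum_{a,l}y_a^l\,l\le b,\quad \sum_{a,l}y_a^l\,\omega_k(a)\le c_k\ (1\le k\le K),\quad 0\le y_a^l\le1,\quad \sum_{a,l}y_a^l=1,\quad \mathbf Q\boldsymbol y=\boldsymbol 0,$$ where $\mathbf Q\boldsymbol y=\boldsymbol 0$ stands for the global-balance equations $$\sum_{l}y_{a+1}^l-\sum_l y_a^l(1-\mu)^l=0\quad(1\le a\le D-2),$$ $$\sum_l\bigl(1-(1-\mu)^l\bigr)y_D^l-\sum_l y_{D-1}^l(1-\mu)^l=0,$$ $$-\sum_l y_1^l(1-\mu)^l+\sum_{a=2}^D\sum_l y_a^l\bigl(1-(1-\mu)^l\bigr)=0.$$ The two problems are equivalent in the following sense. (i) For every initial law, (1) is feasible if and only if the linear program is feasible; and if the linear program is feasible, its minimum is attained. (ii) For every stationary policy $f$, the limits $y_a^l=\lim_{T\to\infty}\frac1T\sum_{t=1}^T\mathbb P(A[t]=a,\,u[t]=l)$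 exist and do not depend on the initial law, and $\lim_{T\to\infty}\frac1T\sum_{t=1}^T\mathbb E[g(A[t],u[t])]=\sum_{a,l}y_a^l\,g(a,l)$ for every function $g$. In particular the objective of $f$ in (1) equals the objective of $y$ in the linear program. Moreover $f$ is feasible, respectively optimal, for (1) if and only if $y$ is feasible, respectively optimal, for the linear program. (iii) Let $y$ be feasible for the linear program and fix, for every age, an arbitrary probability distribution $g_a$ on $\{0,\dots,L\}$. Then $$f_a^l=\begin{cases} y_a^l\big/\sum_{l'}y_a^{l'} & \text{if }\sum_{l'}y_a^{l'}\ne0,\\[2pt] g_a^l & \text{if }\sum_{l'}y_a^{l'}=0\end{cases}$$ defines a stationary policy. Its occupation measures, in the sense of (ii), are $y$ for every initial law, it is feasible for (1), and its objective equals that of $y$. If $y$ is optimal for the linear program, then this policy is optimal for (1) among all randomized history-dependent policies. -/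

import Mathlib

open Filter Topology

noncomputable section

namespace AgeMDP

/-- The data of the single-source age-optimization problem with ages truncated at `D`, `L` on/off
channels and `K` additional average-cost constraints. -/
structure Problem (D L K : ℕ) where
  /-- success probability of a transmission over one channel -/
  μ : unitInterval
  /-- objective cost of an age -/
  ω₀ : ℕ → ℝ
  /-- bound on the long-run average number of channels in use -/
  b : ℝ
  /-- further costs of an age -/
  ω : Fin K → ℕ → ℝ
  /-- bounds on the long-run averages of the further costs -/
  c : Fin K → ℝ

/-- The state space: the index `i : Fin D` stands for the age `i + 1 ∈ {1, …, D}`. -/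
abbrev Age (D : ℕ) := Fin D

/-- The numerical value of an age state. -/
def Age.age {D : ℕ} (a : Age D) : ℕ := (a : Fin D).val + 1

/-- The action space: the number of channels used, in `{0, …, L}`. -/
abbrev Action (L : ℕ) := Fin (L + 1)

/-- The age state of value `1`. -/
def Age.reset {D : ℕ} (a : Age D) : Age D := ⟨0, by have := a.2; omega⟩

/-- The age state of value `min (a + 1) D`. -/
def Age.grow {D : ℕ} (a : Age D) : Age D := ⟨min (Fin.val a + 1) (D - 1), by have := a.2; omega⟩

variable {D L K : ℕ}

/-! ### The controlled Markov chain -/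

/-- The law of the next age: with `l` channels, the update succeeds with probability
`1 - (1 - μ) ^ l`, and then the age is reset to `1`; otherwise it grows by one, up to `D`. -/
def nextAge (μ : unitInterval) (a : Age D) (l : Action L) : PMF (Age D) :=
  PMF.ofFintype
    (fun a' => (if a' = a.reset then ENNReal.ofReal (1 - (1 - (μ : ℝ)) ^ (l : ℕ)) else 0) +
      (if a' = a.grow then ENNReal.ofReal ((1 - (μ : ℝ)) ^ (l : ℕ)) else 0))
    (by
      have h0 : 0 ≤ 1 - (μ : ℝ) := sub_nonneg.2 μ.2.2
      have h1 : (1 - (μ : ℝ)) ^ (l : ℕ) ≤ 1 := pow_le_one₀ h0 (by linarith [μ.2.1])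
      rw [Finset.sum_add_distrib, Finset.sum_ite_eq', Finset.sum_ite_eq']
      simp only [Finset.mem_univ, if_true]
      rw [← ENNReal.ofReal_add (sub_nonneg.2 h1) (pow_nonneg h0 _)]
      simp)

/-- A randomized history-dependent policy: given the list of past age-action pairs (most recent
first; its length is the number of past slots) and the current age, a law on the actions. -/
abbrev Policy (D L : ℕ) := List (Age D × Action L) → Age D → PMF (Action L)

/-- A randomized stationary (Markovian) policy: the probability `f a l` of choosing `l` channels
depends on the current age `a` only. -/
abbrev StationaryPolicy (D L : ℕ) := Age D → PMF (Action L)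

/-- A stationary policy as a history-dependent one. -/
def StationaryPolicy.toPolicy (f : StationaryPolicy D L) : Policy D L := fun _ a => f a

/-- The joint law of the past and the current age after `t` slots, when the initial age has
law `ν` and the policy `p` is used. -/
def historyLaw (μ : unitInterval) (ν : PMF (Age D)) (p : Policy D L) :
    ℕ → PMF (List (Age D × Action L) × Age D)
  | 0 => ν.map fun a => ([], a)
  | t + 1 => (historyLaw μ ν p t).bind fun s =>
      (p s.1 s.2).bind fun l =>
        (nextAge μ s.2 l).map fun a' => ((s.2, l) :: s.1, a')

/-- The joint law of the age and the action in a slot; the slots are numbered `0, 1, 2, …`. -/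
def stateActionLaw (μ : unitInterval) (ν : PMF (Age D)) (p : Policy D L) (t : ℕ) :
    PMF (Age D × Action L) :=
  (historyLaw μ ν p t).bind fun s => (p s.1 s.2).map fun l => (s.2, l)

/-- The expectation of a function of the age and the action in slot `t`. -/
def expectation (μ : unitInterval) (ν : PMF (Age D)) (p : Policy D L)
    (g : Age D → Action L → ℝ) (t : ℕ) : ℝ :=
  ∑ a : Age D, ∑ l : Action L, (stateActionLaw μ ν p t (a, l)).toReal * g a l

/-- The expected average of a function of the age and the action over the first `T` slots. -/
def average (μ : unitInterval) (ν : PMF (Age D)) (p : Policy D L)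
    (g : Age D → Action L → ℝ) (T : ℕ) : ℝ :=
  (1 / (T : ℝ)) * ∑ t ∈ Finset.range T, expectation μ ν p g t

/-- The expected fraction of the first `T` slots in which the age is `a` and `l` channels
are used. -/
def occupation (μ : unitInterval) (ν : PMF (Age D)) (p : Policy D L)
    (a : Age D) (l : Action L) (T : ℕ) : ℝ :=
  (1 / (T : ℝ)) * ∑ t ∈ Finset.range T, (stateActionLaw μ ν p t (a, l)).toReal

/-- The long-run expected average: the limit of the averages when it exists, and their
upper limit in general. -/
def longRunAverage (μ : unitInterval) (ν : PMF (Age D)) (p : Policy D L)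
    (g : Age D → Action L → ℝ) : ℝ :=
  limsup (average μ ν p g) atTop

/-! ### The constrained Markov decision problem -/

/-- The objective: the long-run average of `ω₀ (A[t])`. -/
def Problem.objective (P : Problem D L K) (ν : PMF (Age D)) (p : Policy D L) : ℝ :=
  longRunAverage P.μ ν p fun a _ => P.ω₀ a.age

/-- The average energy constraint and the `K` further average-cost constraints. -/
def Problem.Feasible (P : Problem D L K) (ν : PMF (Age D)) (p : Policy D L) : Prop :=
  longRunAverage P.μ ν p (fun _ l => ((l : ℕ) : ℝ)) ≤ P.b ∧
    ∀ k, longRunAverage P.μ ν p (fun a _ => P.ω k a.age) ≤ P.c k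

/-- Optimality among all randomized history-dependent policies. -/
def Problem.Optimal (P : Problem D L K) (ν : PMF (Age D)) (p : Policy D L) : Prop :=
  P.Feasible ν p ∧ ∀ q, P.Feasible ν q → P.objective ν p ≤ P.objective ν q

/-! ### The linear program -/

/-- The global balance equations `Q y = 0`. -/
structure Balance (μ : unitInterval) (y : Age D → Action L → ℝ) : Prop where
  middle : ∀ a a' : Age D, a'.age = a.age + 1 → a.age ≤ D - 2 →
    ∑ l : Action L, y a' l - ∑ l : Action L, y a l * (1 - (μ : ℝ)) ^ (l : ℕ) = 0
  last : ∀ a a' : Age D, a'.age = D → a.age = D - 1 →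
    ∑ l : Action L, (1 - (1 - (μ : ℝ)) ^ (l : ℕ)) * y a' l - ∑ l : Action L, y a l * (1 - (μ : ℝ)) ^ (l : ℕ) = 0
  first : ∀ a₁ : Age D, a₁.age = 1 →
    -∑ l : Action L, y a₁ l * (1 - (μ : ℝ)) ^ (l : ℕ) +
      ∑ a : Age D with 2 ≤ a.age, ∑ l : Action L, y a l * (1 - (1 - (μ : ℝ)) ^ (l : ℕ)) = 0

/-- The objective function of the linear program. -/
def Problem.lpObjective (P : Problem D L K) (y : Age D → Action L → ℝ) : ℝ :=
  ∑ a : Age D, ∑ l : Action L, y a l * P.ω₀ a.age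

/-- The constraints of the linear program. -/
structure Problem.LPFeasible (P : Problem D L K) (y : Age D → Action L → ℝ) : Prop where
  energy : ∑ a : Age D, ∑ l : Action L, y a l * ((l : ℕ) : ℝ) ≤ P.b
  cost : ∀ k, ∑ a : Age D, ∑ l : Action L, y a l * P.ω k a.age ≤ P.c k
  bounds : ∀ a l, 0 ≤ y a l ∧ y a l ≤ 1
  total : ∑ a : Age D, ∑ l : Action L, y a l = 1
  balance : Balance P.μ y

/-- Optimal solutions of the linear program. -/
def Problem.LPOptimal (P : Problem D L K) (y : Age D → Action L → ℝ) : Prop :=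
  P.LPFeasible y ∧ ∀ z, P.LPFeasible z → P.lpObjective y ≤ P.lpObjective z

/-- The stationary policy `f` is obtained from `y` by normalization at the ages of positive mass
and follows `g` at the ages of zero mass. -/
def IsPolicyOf (y : Age D → Action L → ℝ) (g f : StationaryPolicy D L) : Prop :=
  ∀ a l, (f a l).toReal =
    if ∑ l' : Action L, y a l' ≠ 0 then y a l / ∑ l' : Action L, y a l' else (g a l).toReal

end AgeMDP

end

namespace AgeMDP

variable {D L K : ℕ}

/-! The link between the two problems is the occupation measure of the first `T` slots. For any
policy its balance defect telescopes to a difference of two age laws divided by `T`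
(`sum_occupation_sub`), so every limit point, taken along an ultrafilter in a cube, is a balanced
probability vector. Its costs are at most the upper limits in the decision problem, so the linear
program bounds every history-dependent policy from below (`Feasible.exists_lpFeasible`).

Conversely, a feasible `y` splits as age marginal times action law `f a`. Limit points for the
stationary policy `f` split along the same `f`, and the balance equations determine the marginal
(`eq_of_balance`): since `μ < 1`, they can be solved downwards from age `D` with positive
coefficients. All limit points therefore equal `y`, whatever the initial law, and the occupation
measures converge (`tendsto_occupation`). No ergodic theorem is needed. Attainment of the minimum is
compactness. -/

/-- The law of the age in slot `t`. -/
noncomputable def ageLaw (μ : unitInterval) (ν : PMF (Age D)) (p : Policy D L) (t : ℕ) : PMF (Age D) :=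
  (historyLaw μ ν p t).map Prod.snd

/-- A vector of state-action frequencies that is invariant under the controlled transitions. -/
def IsStationary (μ : unitInterval) (y : Age D → Action L → ℝ) : Prop :=
  ∀ a', ∑ l, y a' l = ∑ a, ∑ l, y a l * (nextAge μ a l a').toReal

theorem one_sub_pow_nonneg (μ : unitInterval) (l : ℕ) : 0 ≤ (1 - (μ : ℝ)) ^ l :=
  pow_nonneg (sub_nonneg.2 μ.2.2) _

theorem one_sub_pow_le_one (μ : unitInterval) (l : ℕ) : (1 - (μ : ℝ)) ^ l ≤ 1 :=
  pow_le_one₀ (sub_nonneg.2 μ.2.2) (by linarith [μ.2.1])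

theorem nextAge_toReal (μ : unitInterval) (a : Age D) (l : Action L) (a' : Age D) :
    (nextAge μ a l a').toReal =
      (if a' = a.reset then 1 - (1 - (μ : ℝ)) ^ (l : ℕ) else 0) +
        (if a' = a.grow then (1 - (μ : ℝ)) ^ (l : ℕ) else 0) := by
  have h0 := one_sub_pow_nonneg μ l
  have h1 := sub_nonneg.2 (one_sub_pow_le_one μ l)
  rw [nextAge, PMF.ofFintype_apply, ENNReal.toReal_add (by split_ifs <;> simp)
    (by split_ifs <;> simp)]
  split_ifs <;> simp [h0, h1, ENNReal.toReal_ofReal]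

theorem sum_toReal {α : Type*} [Fintype α] (m : PMF α) : ∑ a, (m a).toReal = 1 := by
  rw [← ENNReal.toReal_sum fun a _ => m.apply_ne_top a, ← tsum_fintype (L := .unconditional _),
    m.tsum_coe, ENNReal.toReal_one]

/-! ### Stationarity and the global balance equations -/

theorem IsStationary.sum_eq {μ : unitInterval} {y : Age D → Action L → ℝ}
    (h : IsStationary μ y) (a' : Age D) :
    ∑ l, y a' l =
      ∑ a : Age D, ((if a' = a.reset then ∑ l, y a l * (1 - (1 - (μ : ℝ)) ^ (l : ℕ)) else 0) +
        (if a' = a.grow then ∑ l, y a l * (1 - (μ : ℝ)) ^ (l : ℕ) else 0)) := by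
  rw [h a']
  refine Finset.sum_congr rfl fun a _ => ?_
  simp only [nextAge_toReal, mul_add, Finset.sum_add_distrib]
  split_ifs <;> simp

theorem sum_mul_one_sub (y : Action L → ℝ) (q : Action L → ℝ) :
    ∑ l, y l * (1 - q l) = ∑ l, y l - ∑ l, y l * q l := by
  simp [mul_sub]

/-- An intermediate age is entered only by growth from its predecessor, age `D` by growth from `D -
1` or from itself, and age `1` only by reset, possible from every age. -/
theorem IsStationary.balance {μ : unitInterval} {y : Age D → Action L → ℝ} (hD : 2 ≤ D)
    (h : IsStationary μ y) : Balance μ y where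
  middle a a' h1 h2 := by
    rw [h.sum_eq a', Finset.sum_add_distrib, Finset.sum_eq_zero, zero_add,
      Finset.sum_eq_single a, if_pos, sub_self]
    · ext
      simp only [Age.age, Age.grow] at *
      omega
    · intro c _ hc
      refine if_neg fun e => hc ?_
      rw [Fin.ext_iff] at e ⊢
      simp only [Age.age, Age.grow] at *
      omega
    · simp
    · intro c _
      refine if_neg fun e => ?_
      rw [Fin.ext_iff] at e
      simp only [Age.age, Age.reset] at *
      omega
  last a a' h1 h2 := by
    have hne : a ≠ a' := by
      rintro rfl
      omega
    have e := h.sum_eq a'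
    rw [Finset.sum_add_distrib, Finset.sum_eq_zero (s := Finset.univ)
      (f := fun c : Age D => if a' = c.reset then _ else _), zero_add,
      Finset.sum_eq_add a a' hne, if_pos, if_pos] at e
    · have := sum_mul_one_sub (y a') fun l => (1 - (μ : ℝ)) ^ (l : ℕ)
      simp only [mul_comm (_ - _)]
      rw [this]
      linarith
    · ext
      simp only [Age.age, Age.grow] at *
      omega
    · ext
      simp only [Age.age, Age.grow] at *
      omega
    · rintro c - ⟨hc, hc'⟩
      refine if_neg fun e => ?_
      rw [Ne, Fin.ext_iff] at hc hc'
      rw [Fin.ext_iff] at e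
      simp only [Age.age, Age.grow] at *
      omega
    · simp
    · simp
    · intro c _
      refine if_neg fun e => ?_
      rw [Fin.ext_iff] at e
      simp only [Age.age, Age.reset] at *
      omega
  first a h1 := by
    have e := h.sum_eq a
    have hr : ∀ c : Age D, a = c.reset := fun c => by
      ext
      simp only [Age.age, Age.reset] at *
      omega
    have hg : ∀ c : Age D, a ≠ c.grow := fun c e => by
      rw [Fin.ext_iff] at e
      simp only [Age.age, Age.grow] at *
      have := c.2
      omega
    simp only [← hr, hg, if_true, if_false, add_zero] at e
    have hs : Finset.univ.filter (fun c : Age D => 2 ≤ c.age) = Finset.univ.erase a := by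
      ext c
      simp only [Finset.mem_filter, Finset.mem_univ, true_and, Finset.mem_erase, and_true, Ne,
        Fin.ext_iff]
      simp only [Age.age] at *
      omega
    rw [hs]
    rw [← Finset.add_sum_erase _ _ (Finset.mem_univ a), sum_mul_one_sub] at e
    linarith

/-- The mass of the age `D` controls the signs of the masses of all ages. -/
theorem nonneg_of_balance {μ : unitInterval} (hD : 2 ≤ D) (hμ : (μ : ℝ) < 1)
    {f : StationaryPolicy D L} {s : Age D → ℝ}
    (h : Balance μ fun a l => s a * (f a l).toReal)
    (hs : 0 ≤ s ⟨D - 1, by omega⟩) (a : Age D) : 0 ≤ s a := by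
  have hf : ∀ a, ∑ l, (f a l).toReal = 1 := fun a => sum_toReal (f a)
  have hq : ∀ a, 0 < ∑ l, (f a l).toReal * (1 - (μ : ℝ)) ^ (l : ℕ) := fun a => by
    have hp : ∀ l : Action L, 0 < (1 - (μ : ℝ)) ^ (l : ℕ) := fun l => pow_pos (by linarith) _
    -- The failure probability at each age is an average of positive numbers, because `μ < 1`.
    refine (Finset.sum_nonneg fun l _ => mul_nonneg ENNReal.toReal_nonneg (hp l).le).lt_of_ne
      fun e => ?_
    have e' := (Finset.sum_eq_zero_iff_of_nonneg fun l _ =>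
      mul_nonneg ENNReal.toReal_nonneg (hp l).le).1 e.symm
    have : ∑ l, (f a l).toReal = 0 := Finset.sum_eq_zero fun l hl =>
      (mul_eq_zero.1 (e' l hl)).resolve_right (hp l).ne'
    linarith [hf a]
  have key : ∀ k (hk : k < D), 0 ≤ s ⟨D - 1 - k, by omega⟩ := by
    intro k
    induction k with
    | zero => exact fun _ => hs
    | succ k ih =>
      intro hk
      have hk' := ih (by omega)
      have hq' := hq ⟨D - 1 - (k + 1), by omega⟩
      -- The step from `D` to `D - 1` uses the `last` equation, as age `D` also feeds itself.
      rcases Nat.eq_zero_or_pos k with rfl | hk0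
      · have e := h.last ⟨D - 1 - (0 + 1), by omega⟩ ⟨D - 1 - 0, by omega⟩
          (by simp only [Age.age]; omega) (by simp only [Age.age]; omega)
        simp only [mul_assoc, ← Finset.mul_sum, mul_left_comm _ (s _)] at e
        refine nonneg_of_mul_nonneg_left ?_ hq'
        rw [← sub_eq_zero.1 e]
        exact mul_nonneg hk' (Finset.sum_nonneg fun l _ =>
          mul_nonneg (sub_nonneg.2 (one_sub_pow_le_one μ l)) ENNReal.toReal_nonneg)
      · have e := h.middle ⟨D - 1 - (k + 1), by omega⟩ ⟨D - 1 - k, by omega⟩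
          (by simp only [Age.age]; omega) (by simp only [Age.age]; omega)
        simp only [mul_assoc, ← Finset.mul_sum, hf, mul_one] at e
        refine nonneg_of_mul_nonneg_left ?_ hq'
        rw [← sub_eq_zero.1 e]
        exact hk'
  have := key (D - 1 - a) (by omega)
  convert this using 2
  ext
  simp only
  have := a.2
  omega

theorem Balance.sub {μ : unitInterval} {y z : Age D → Action L → ℝ} (hy : Balance μ y)
    (hz : Balance μ z) : Balance μ fun a l => y a l - z a l where
  middle a a' h1 h2 := by
    have e1 := hy.middle a a' h1 h2
    have e2 := hz.middle a a' h1 h2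
    simp only [sub_mul, Finset.sum_sub_distrib]
    linarith
  last a a' h1 h2 := by
    have e1 := hy.last a a' h1 h2
    have e2 := hz.last a a' h1 h2
    simp only [mul_sub (1 - (1 - (μ : ℝ)) ^ (_ : ℕ)) (y _ _), sub_mul (y _ _), Finset.sum_sub_distrib]
    linarith
  first a h1 := by
    have e1 := hy.first a h1
    have e2 := hz.first a h1
    simp only [sub_mul, Finset.sum_sub_distrib]
    linarith

/-- Balance is linear, so the sign statement applies to `s' - s`. -/
theorem le_of_balance {μ : unitInterval} (hD : 2 ≤ D) (hμ : (μ : ℝ) < 1)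
    {f : StationaryPolicy D L} {s s' : Age D → ℝ}
    (h : Balance μ fun a l => s a * (f a l).toReal)
    (h' : Balance μ fun a l => s' a * (f a l).toReal)
    (hs : s ⟨D - 1, by omega⟩ ≤ s' ⟨D - 1, by omega⟩) : s ≤ s' := fun a => by
  have := h'.sub h
  simp only [← sub_mul] at this
  exact sub_nonneg.1 (nonneg_of_balance hD hμ (s := fun a => s' a - s a) this (sub_nonneg.2 hs) a)

/-- The balance equations determine the age marginal of a stationary policy. -/
theorem eq_of_balance {μ : unitInterval} (hD : 2 ≤ D) (hμ : (μ : ℝ) < 1)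
    {f : StationaryPolicy D L} {s s' : Age D → ℝ}
    (h : Balance μ fun a l => s a * (f a l).toReal)
    (h' : Balance μ fun a l => s' a * (f a l).toReal)
    (hs : ∑ a, s a = ∑ a, s' a) : s = s' := by
  rcases le_total (s ⟨D - 1, by omega⟩) (s' ⟨D - 1, by omega⟩) with hle | hle
  · have hle := le_of_balance hD hμ h h' hle
    exact funext fun a => (Finset.sum_eq_sum_iff_of_le fun a _ => hle a).1 hs a (Finset.mem_univ a)
  · have hle := le_of_balance hD hμ h' h hle
    exact funext fun a =>
      ((Finset.sum_eq_sum_iff_of_le fun a _ => hle a).1 hs.symm a (Finset.mem_univ a)).symm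

/-! ### One-step evolution of the laws -/

theorem bind_toReal {α β : Type*} [Fintype α] (m : PMF α) (k : α → PMF β) (b : β) :
    (m.bind k b).toReal = ∑ a, (m a).toReal * (k a b).toReal := by
  rw [PMF.bind_apply, tsum_fintype, ENNReal.toReal_sum fun a _ =>
    ENNReal.mul_ne_top (m.apply_ne_top a) ((k a).apply_ne_top b)]
  simp only [ENNReal.toReal_mul]

theorem map_fst_stateActionLaw (μ : unitInterval) (ν : PMF (Age D)) (p : Policy D L) (t : ℕ) :
    (stateActionLaw μ ν p t).map Prod.fst = ageLaw μ ν p t := by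
  simp only [stateActionLaw, ageLaw, PMF.map_bind, PMF.map_comp]
  rw [← PMF.bind_pure_comp]
  congr 1
  funext s
  exact PMF.map_const _ _

theorem ageLaw_succ (μ : unitInterval) (ν : PMF (Age D)) (p : Policy D L) (t : ℕ) :
    ageLaw μ ν p (t + 1) = (stateActionLaw μ ν p t).bind fun s => nextAge μ s.1 s.2 := by
  simp only [stateActionLaw, ageLaw, historyLaw, PMF.map_bind, PMF.map_comp, PMF.bind_bind,
    PMF.bind_map]
  congr! 5
  exact PMF.map_id _

theorem stateActionLaw_toPolicy (μ : unitInterval) (ν : PMF (Age D)) (f : StationaryPolicy D L)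
    (t : ℕ) : stateActionLaw μ ν f.toPolicy t =
      (ageLaw μ ν f.toPolicy t).bind fun a => (f a).map fun l => (a, l) := by
  rw [ageLaw, PMF.bind_map]
  rfl

theorem sum_stateActionLaw (μ : unitInterval) (ν : PMF (Age D)) (p : Policy D L) (t : ℕ)
    (a : Age D) : ∑ l, (stateActionLaw μ ν p t (a, l)).toReal = (ageLaw μ ν p t a).toReal := by
  rw [← map_fst_stateActionLaw, ← PMF.bind_pure_comp, bind_toReal, Fintype.sum_prod_type,
    Finset.sum_eq_single a]
  · simp
  · intro b _ hb
    simp [PMF.pure_apply, hb.symm]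
  · simp

theorem ageLaw_succ_toReal (μ : unitInterval) (ν : PMF (Age D)) (p : Policy D L) (t : ℕ)
    (a' : Age D) : (ageLaw μ ν p (t + 1) a').toReal =
      ∑ a, ∑ l, (stateActionLaw μ ν p t (a, l)).toReal * (nextAge μ a l a').toReal := by
  rw [ageLaw_succ, bind_toReal, Fintype.sum_prod_type]

/-- The age marginal is written as a sum over actions so that the identity is linear in the
state-action law and survives time averages and limits. -/
theorem stateActionLaw_toPolicy_toReal (μ : unitInterval) (ν : PMF (Age D))
    (f : StationaryPolicy D L) (t : ℕ) (a : Age D) (l : Action L) :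
    (stateActionLaw μ ν f.toPolicy t (a, l)).toReal =
      (∑ l', (stateActionLaw μ ν f.toPolicy t (a, l')).toReal) * (f a l).toReal := by
  rw [sum_stateActionLaw, stateActionLaw_toPolicy, bind_toReal, Finset.sum_eq_single a]
  · rw [← PMF.bind_pure_comp, bind_toReal, Finset.sum_eq_single l]
    · simp
    · intro b _ hb
      simp [PMF.pure_apply, hb.symm]
    · simp
  · intro b _ hb
    rw [← PMF.bind_pure_comp, bind_toReal]
    simp [PMF.pure_apply, hb.symm]
  · simp

/-! ### Occupation measures and their limits -/

section Occupation

variable (μ : unitInterval) (ν : PMF (Age D)) (p : Policy D L)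

theorem average_eq_sum_occupation (g : Age D → Action L → ℝ) (T : ℕ) :
    average μ ν p g T = ∑ a, ∑ l, occupation μ ν p a l T * g a l := by
  simp only [average, expectation, occupation, mul_assoc, Finset.sum_mul, ← Finset.mul_sum]
  congr 1
  rw [Finset.sum_comm]
  refine Finset.sum_congr rfl fun a _ => Finset.sum_comm

theorem occupation_mem_Icc (a : Age D) (l : Action L) (T : ℕ) :
    occupation μ ν p a l T ∈ Set.Icc (0 : ℝ) 1 := by
  refine ⟨mul_nonneg (by positivity) (Finset.sum_nonneg fun t _ => ENNReal.toReal_nonneg), ?_⟩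
  rw [occupation, one_div, inv_mul_eq_div]
  refine div_le_one_of_le₀ ?_ (Nat.cast_nonneg T)
  calc _ ≤ ∑ t ∈ Finset.range T, (1 : ℝ) := Finset.sum_le_sum fun t _ =>
        ENNReal.toReal_le_of_le_ofReal zero_le_one (by simpa using PMF.coe_le_one _ _)
    _ = T := by simp

theorem sum_occupation {T : ℕ} (hT : T ≠ 0) : ∑ a, ∑ l, occupation μ ν p a l T = 1 := by
  have h := average_eq_sum_occupation μ ν p (fun _ _ => 1) T
  simp only [mul_one] at h
  rw [← h, average]
  have : ∀ t, expectation μ ν p (fun _ _ => 1) t = 1 := fun t => by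
    simp only [expectation, mul_one, sum_stateActionLaw, sum_toReal]
  have hT' : (T : ℝ) ≠ 0 := Nat.cast_ne_zero.2 hT
  simp [this, hT']

/-- Pushing the law of slot `t` through the transition gives the age law of slot `t + 1`, so the sum
telescopes. -/
theorem sum_occupation_sub (a' : Age D) (T : ℕ) :
    ∑ l, occupation μ ν p a' l T -
        ∑ a, ∑ l, occupation μ ν p a l T * (nextAge μ a l a').toReal =
      (1 / (T : ℝ)) * ((ageLaw μ ν p 0 a').toReal - (ageLaw μ ν p T a').toReal) := by
  have h1 : ∑ l, occupation μ ν p a' l T =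
      (1 / (T : ℝ)) * ∑ t ∈ Finset.range T, (ageLaw μ ν p t a').toReal := by
    simp only [occupation, ← Finset.mul_sum, ← sum_stateActionLaw]
    rw [Finset.sum_comm]
  have h2 : ∑ a, ∑ l, occupation μ ν p a l T * (nextAge μ a l a').toReal =
      (1 / (T : ℝ)) * ∑ t ∈ Finset.range T, (ageLaw μ ν p (t + 1) a').toReal := by
    rw [← average_eq_sum_occupation μ ν p (fun a l => (nextAge μ a l a').toReal)]
    simp only [average, expectation, ageLaw_succ_toReal]
  rw [h1, h2, ← mul_sub, ← Finset.sum_sub_distrib, Finset.sum_range_sub']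

variable {μ ν p}

theorem tendsto_average {F : Filter ℕ} {y : Age D → Action L → ℝ}
    (h : ∀ a l, Tendsto (occupation μ ν p a l) F (𝓝 (y a l))) (g : Age D → Action L → ℝ) :
    Tendsto (average μ ν p g) F (𝓝 (∑ a, ∑ l, y a l * g a l)) := by
  rw [funext (average_eq_sum_occupation μ ν p g)]
  exact tendsto_finsetSum _ fun a _ => tendsto_finsetSum _ fun l _ => (h a l).mul_const _

theorem mem_Icc_of_tendsto_occupation {F : Filter ℕ} [F.NeBot] {y : Age D → Action L → ℝ}
    (h : ∀ a l, Tendsto (occupation μ ν p a l) F (𝓝 (y a l))) (a : Age D) (l : Action L) :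
    0 ≤ y a l ∧ y a l ≤ 1 :=
  isClosed_Icc.mem_of_tendsto (h a l) (Eventually.of_forall (occupation_mem_Icc μ ν p a l))

theorem sum_eq_one_of_tendsto_occupation {F : Filter ℕ} [F.NeBot] (hF : F ≤ atTop)
    {y : Age D → Action L → ℝ} (h : ∀ a l, Tendsto (occupation μ ν p a l) F (𝓝 (y a l))) :
    ∑ a, ∑ l, y a l = 1 := by
  refine tendsto_nhds_unique (tendsto_finsetSum _ fun a _ => tendsto_finsetSum _ fun l _ => h a l)
    (tendsto_const_nhds.congr' ?_)
  -- At `T = 0` the occupation is `0`, since `1 / 0 = 0`.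
  filter_upwards [hF (eventually_ne_atTop 0)] with T hT
  exact (sum_occupation μ ν p hT).symm

theorem isStationary_of_tendsto_occupation {F : Filter ℕ} [F.NeBot] (hF : F ≤ atTop)
    {y : Age D → Action L → ℝ} (h : ∀ a l, Tendsto (occupation μ ν p a l) F (𝓝 (y a l))) :
    IsStationary μ y := fun a' => by
  rw [← sub_eq_zero]
  refine tendsto_nhds_unique ((tendsto_finsetSum _ fun l _ => h a' l).sub
    (tendsto_finsetSum _ fun a _ => tendsto_finsetSum _ fun l _ =>
      (h a l).mul_const (nextAge μ a l a').toReal)) (Tendsto.mono_left ?_ hF)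
  simp only [sum_occupation_sub]
  refine (tendsto_one_div_atTop_nhds_zero_nat (𝕜 := ℝ)).zero_mul_isBoundedUnder_le ?_
  refine isBoundedUnder_of ⟨1, fun T => ?_⟩
  have hle : ∀ t, (ageLaw μ ν p t a').toReal ≤ 1 := fun t =>
    ENNReal.toReal_le_of_le_ofReal zero_le_one (by simpa using PMF.coe_le_one _ _)
  have hnn : ∀ t, 0 ≤ (ageLaw μ ν p t a').toReal := fun t => ENNReal.toReal_nonneg
  simp only [Function.comp_apply, Real.norm_eq_abs, abs_le]
  constructor <;> linarith [hle 0, hle T, hnn 0, hnn T]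

-- An ultrafilter converges in the compact `[0, 1]`, which gives limits for all pairs at once
-- without extracting subsequences.
variable (μ ν p) in
theorem exists_tendsto_occupation (U : Ultrafilter ℕ) :
    ∃ y : Age D → Action L → ℝ, ∀ a l, Tendsto (occupation μ ν p a l) U (𝓝 (y a l)) := by
  have : ∀ a l, ∃ x, Tendsto (occupation μ ν p a l) U (𝓝 x) := fun a l => by
    obtain ⟨x, -, hx⟩ := isCompact_Icc.ultrafilter_le_nhds (U.map (occupation μ ν p a l))
      (le_principal_iff.2 (Filter.mem_map.2
        (Filter.univ_mem' (occupation_mem_Icc μ ν p a l))))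
    exact ⟨x, hx⟩
  choose y hy using this
  exact ⟨y, hy⟩

variable (μ ν p) in
theorem abs_average_le (g : Age D → Action L → ℝ) (T : ℕ) :
    |average μ ν p g T| ≤ ∑ a, ∑ l, |g a l| := by
  rw [average_eq_sum_occupation]
  refine (Finset.abs_sum_le_sum_abs _ _).trans (Finset.sum_le_sum fun a _ =>
    (Finset.abs_sum_le_sum_abs _ _).trans (Finset.sum_le_sum fun l _ => ?_))
  have h := occupation_mem_Icc μ ν p a l T
  rw [abs_mul, abs_of_nonneg h.1]
  exact mul_le_of_le_one_left (abs_nonneg _) h.2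

/-- A limit along a finer filter is at most the upper limit; boundedness of the averages keeps the
real `limsup` from being a default value. -/
theorem sum_le_longRunAverage {F : Filter ℕ} [F.NeBot] (hF : F ≤ atTop)
    {y : Age D → Action L → ℝ} (h : ∀ a l, Tendsto (occupation μ ν p a l) F (𝓝 (y a l)))
    (g : Age D → Action L → ℝ) : ∑ a, ∑ l, y a l * g a l ≤ longRunAverage μ ν p g := by
  have hb := fun T => abs_le.1 (abs_average_le μ ν p g T)
  rw [← (tendsto_average h g).limsup_eq]
  exact limsup_le_limsup_of_le hF
    (isBoundedUnder_of (r := (· ≥ ·)) ⟨_, fun T => (hb T).1⟩).isCoboundedUnder_le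
    (isBoundedUnder_of (r := (· ≤ ·)) ⟨_, fun T => (hb T).2⟩)

theorem longRunAverage_eq {y : Age D → Action L → ℝ}
    (h : ∀ a l, Tendsto (occupation μ ν p a l) atTop (𝓝 (y a l))) (g : Age D → Action L → ℝ) :
    longRunAverage μ ν p g = ∑ a, ∑ l, y a l * g a l :=
  (tendsto_average h g).limsup_eq

theorem eq_sum_mul_of_tendsto_occupation {F : Filter ℕ} [F.NeBot] {f : StationaryPolicy D L}
    {y : Age D → Action L → ℝ}
    (h : ∀ a l, Tendsto (occupation μ ν f.toPolicy a l) F (𝓝 (y a l))) (a : Age D)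
    (l : Action L) : y a l = (∑ l', y a l') * (f a l).toReal := by
  refine tendsto_nhds_unique (h a l)
    (((tendsto_finsetSum _ fun l' _ => h a l').mul_const _).congr fun T => ?_)
  simp only [occupation, ← Finset.mul_sum, mul_assoc]
  rw [Finset.sum_comm, Finset.sum_mul]
  simp only [← stateActionLaw_toPolicy_toReal]

/-- A balanced probability vector that disintegrates along a stationary policy is the limit of the
occupation measures of the policy. -/
theorem tendsto_occupation (hD : 2 ≤ D) (hμ : (μ : ℝ) < 1) {f : StationaryPolicy D L}
    {y : Age D → Action L → ℝ} (hy : Balance μ y) (hy1 : ∑ a, ∑ l, y a l = 1)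
    (hyf : ∀ a l, y a l = (∑ l', y a l') * (f a l).toReal) (a : Age D) (l : Action L) :
    Tendsto (occupation μ ν f.toPolicy a l) atTop (𝓝 (y a l)) := by
  rw [tendsto_iff_ultrafilter]
  intro U hU
  obtain ⟨z, hz⟩ := exists_tendsto_occupation μ ν f.toPolicy U
  have hzb := (isStationary_of_tendsto_occupation hU hz).balance hD
  have hzf := eq_sum_mul_of_tendsto_occupation hz
  have hyz : (fun a => ∑ l, y a l) = fun a => ∑ l, z a l := by
    refine eq_of_balance hD hμ (f := f) ?_ ?_
      (hy1.trans (sum_eq_one_of_tendsto_occupation hU hz).symm)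
    · simpa only [← hyf] using hy
    · simpa only [← hzf] using hzb
  rw [hyf a l, congrFun hyz a, ← hzf a l]
  exact hz a l

variable (μ) in
theorem exists_limit_occupation (hD : 2 ≤ D) (hμ : (μ : ℝ) < 1) (f : StationaryPolicy D L) :
    ∃ y : Age D → Action L → ℝ, ∀ ν : PMF (Age D), ∀ a l,
      Tendsto (occupation μ ν f.toPolicy a l) atTop (𝓝 (y a l)) := by
  -- One limit point from one arbitrary initial law suffices: being balanced and split along `f`, it
  -- is the limit for every law.
  obtain ⟨y, hy⟩ := exists_tendsto_occupation μ (PMF.pure ⟨0, by omega⟩) f.toPolicy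
    (Ultrafilter.of atTop)
  have hU : ((Ultrafilter.of atTop : Ultrafilter ℕ) : Filter ℕ) ≤ atTop := Ultrafilter.of_le _
  exact ⟨y, fun ν => tendsto_occupation hD hμ
    ((isStationary_of_tendsto_occupation hU hy).balance hD)
    (sum_eq_one_of_tendsto_occupation hU hy) (eq_sum_mul_of_tendsto_occupation hy)⟩

end Occupation

/-! ### The decision problem and the linear program -/

namespace Problem

variable {P : Problem D L K} {ν : PMF (Age D)}

/-- A single limit point serves all constraints and the objective simultaneously. -/
theorem Feasible.exists_lpFeasible (hD : 2 ≤ D) {p : Policy D L} (h : P.Feasible ν p) :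
    ∃ y, P.LPFeasible y ∧ P.lpObjective y ≤ P.objective ν p := by
  obtain ⟨y, hy⟩ := exists_tendsto_occupation P.μ ν p (Ultrafilter.of atTop)
  have hU : ((Ultrafilter.of atTop : Ultrafilter ℕ) : Filter ℕ) ≤ atTop := Ultrafilter.of_le _
  have hle := sum_le_longRunAverage hU hy
  exact ⟨y, ⟨(hle _).trans h.1, fun k => (hle _).trans (h.2 k), mem_Icc_of_tendsto_occupation hy,
    sum_eq_one_of_tendsto_occupation hU hy,
    (isStationary_of_tendsto_occupation hU hy).balance hD⟩, hle _⟩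

theorem objective_eq {p : Policy D L} {y : Age D → Action L → ℝ}
    (h : ∀ a l, Tendsto (occupation P.μ ν p a l) atTop (𝓝 (y a l))) :
    P.objective ν p = P.lpObjective y :=
  longRunAverage_eq h _

theorem feasible_iff (hD : 2 ≤ D) {p : Policy D L} {y : Age D → Action L → ℝ}
    (h : ∀ a l, Tendsto (occupation P.μ ν p a l) atTop (𝓝 (y a l))) :
    P.Feasible ν p ↔ P.LPFeasible y := by
  simp only [Feasible, longRunAverage_eq h]
  exact ⟨fun H => ⟨H.1, H.2, mem_Icc_of_tendsto_occupation h,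
    sum_eq_one_of_tendsto_occupation le_rfl h,
    (isStationary_of_tendsto_occupation le_rfl h).balance hD⟩, fun H => ⟨H.energy, H.cost⟩⟩

theorem exists_isPolicyOf {y : Age D → Action L → ℝ} (hy : ∀ a l, 0 ≤ y a l)
    (g : StationaryPolicy D L) : ∃ f : StationaryPolicy D L, IsPolicyOf y g f := by
  have : ∀ a, ∃ m : PMF (Action L), ∀ l, (m l).toReal =
      if ∑ l', y a l' ≠ 0 then y a l / ∑ l', y a l' else (g a l).toReal := fun a => by
    by_cases hs : ∑ l', y a l' = 0
    · exact ⟨g a, fun l => by simp [hs]⟩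
    · have h0 : ∀ l, 0 ≤ y a l / ∑ l', y a l' := fun l =>
        div_nonneg (hy a l) (Finset.sum_nonneg fun l' _ => hy a l')
      refine ⟨PMF.ofFintype (fun l => ENNReal.ofReal (y a l / ∑ l', y a l')) ?_, fun l => ?_⟩
      · rw [← ENNReal.ofReal_sum_of_nonneg fun l _ => h0 l, ← Finset.sum_div, div_self hs,
          ENNReal.ofReal_one]
      · rw [PMF.ofFintype_apply, ENNReal.toReal_ofReal (h0 l), if_pos hs]
  choose f hf using this
  exact ⟨f, hf⟩

theorem eq_sum_mul_of_isPolicyOf {y : Age D → Action L → ℝ} (hy : ∀ a l, 0 ≤ y a l)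
    {f g : StationaryPolicy D L} (h : IsPolicyOf y g f) (a : Age D) (l : Action L) :
    y a l = (∑ l', y a l') * (f a l).toReal := by
  rw [h a l]
  split_ifs with hs
  · rw [mul_div_cancel₀ _ hs]
  · rw [not_not] at hs
    rw [hs, zero_mul]
    -- At an age of zero mass every `y a l` vanishes, so the choice `g` is immaterial.
    exact (Finset.sum_eq_zero_iff_of_nonneg fun l _ => hy a l).1 hs l (Finset.mem_univ l)

theorem LPFeasible.exists_policy (hD : 2 ≤ D) (hμ : (P.μ : ℝ) < 1) {y : Age D → Action L → ℝ}
    (hy : P.LPFeasible y) (g : StationaryPolicy D L) :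
    ∃ f : StationaryPolicy D L, IsPolicyOf y g f ∧ ∀ ν : PMF (Age D), ∀ a l,
      Tendsto (occupation P.μ ν f.toPolicy a l) atTop (𝓝 (y a l)) := by
  have h0 : ∀ a l, 0 ≤ y a l := fun a l => (hy.bounds a l).1
  obtain ⟨f, hf⟩ := exists_isPolicyOf h0 g
  exact ⟨f, hf, fun ν =>
    tendsto_occupation hD hμ hy.balance hy.total (eq_sum_mul_of_isPolicyOf h0 hf)⟩

theorem isClosed_setOf_balance (μ : unitInterval) :
    IsClosed {y : Age D → Action L → ℝ | Balance μ y} := by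
  have : {y : Age D → Action L → ℝ | Balance μ y} =
      {y | ∀ a a' : Age D, a'.age = a.age + 1 → a.age ≤ D - 2 →
        ∑ l : Action L, y a' l - ∑ l : Action L, y a l * (1 - (μ : ℝ)) ^ (l : ℕ) = 0} ∩
      {y | ∀ a a' : Age D, a'.age = D → a.age = D - 1 →
        ∑ l : Action L, (1 - (1 - (μ : ℝ)) ^ (l : ℕ)) * y a' l -
          ∑ l : Action L, y a l * (1 - (μ : ℝ)) ^ (l : ℕ) = 0} ∩
      {y | ∀ a₁ : Age D, a₁.age = 1 → -∑ l : Action L, y a₁ l * (1 - (μ : ℝ)) ^ (l : ℕ) +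
        ∑ a : Age D with 2 ≤ a.age, ∑ l : Action L, y a l * (1 - (1 - (μ : ℝ)) ^ (l : ℕ)) = 0} :=
    Set.ext fun y => ⟨fun h => ⟨⟨h.middle, h.last⟩, h.first⟩, fun h => ⟨h.1.1, h.1.2, h.2⟩⟩
  rw [this]
  simp only [Set.ofPred_forall]
  refine ((isClosed_iInter fun a => isClosed_iInter fun a' => isClosed_iInter fun _ =>
    isClosed_iInter fun _ => ?_).inter (isClosed_iInter fun a => isClosed_iInter fun a' =>
    isClosed_iInter fun _ => isClosed_iInter fun _ => ?_)).inter
    (isClosed_iInter fun a => isClosed_iInter fun _ => ?_) <;>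
  exact isClosed_eq (by fun_prop) continuous_const

/-- The feasible set is a closed part of the unit cube. -/
theorem isCompact_setOf_lpFeasible (P : Problem D L K) : IsCompact {y | P.LPFeasible y} := by
  have : {y | P.LPFeasible y} = Set.Icc 0 1 ∩
      ({y | ∑ a : Age D, ∑ l : Action L, y a l * ((l : ℕ) : ℝ) ≤ P.b} ∩
      (⋂ k, {y | ∑ a : Age D, ∑ l : Action L, y a l * P.ω k a.age ≤ P.c k}) ∩
      {y | ∑ a : Age D, ∑ l : Action L, y a l = 1} ∩ {y | Balance P.μ y}) := by
    ext y
    constructor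
    · exact fun h => ⟨⟨fun a l => (h.bounds a l).1, fun a l => (h.bounds a l).2⟩,
        ⟨⟨h.energy, Set.mem_iInter.2 h.cost⟩, h.total⟩, h.balance⟩
    · rintro ⟨h0, ⟨⟨h1, h2⟩, h3⟩, h4⟩
      exact ⟨h1, Set.mem_iInter.1 h2, fun a l => ⟨h0.1 a l, h0.2 a l⟩, h3, h4⟩
  rw [this]
  refine isCompact_Icc.inter_right (((IsClosed.inter ?_ (isClosed_iInter fun k => ?_)).inter
    ?_).inter (isClosed_setOf_balance _))
  · exact isClosed_le (by fun_prop) continuous_const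
  · exact isClosed_le (by fun_prop) continuous_const
  · exact isClosed_eq (by fun_prop) continuous_const

theorem exists_lpOptimal (h : ∃ y, P.LPFeasible y) : ∃ y, P.LPOptimal y := by
  have hc : Continuous P.lpObjective := by
    unfold lpObjective
    fun_prop
  obtain ⟨y, hy, hmin⟩ := P.isCompact_setOf_lpFeasible.exists_isMinOn h hc.continuousOn
  exact ⟨y, hy, fun z hz => hmin hz⟩

theorem optimal_iff (hD : 2 ≤ D) (hμ : (P.μ : ℝ) < 1) {p : Policy D L}
    {y : Age D → Action L → ℝ} (h : ∀ a l, Tendsto (occupation P.μ ν p a l) atTop (𝓝 (y a l))) :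
    P.Optimal ν p ↔ P.LPOptimal y := by
  simp only [Optimal, LPOptimal, feasible_iff hD h, objective_eq h]
  refine and_congr_right fun _ => ⟨fun H z hz => ?_, fun H q hq => ?_⟩
  -- A competitor in the linear program is realized by a stationary policy; in the other direction a
  -- competing policy is bounded below by a limit point.
  · obtain ⟨f, -, hf⟩ := hz.exists_policy hD hμ fun _ => PMF.pure 0
    rw [← objective_eq (hf ν)]
    exact H _ ((feasible_iff hD (hf ν)).2 hz)
  · obtain ⟨z, hz, hle⟩ := hq.exists_lpFeasible hD
    exact (H z hz).trans hle

end Problem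

end AgeMDP

theorem theorem1 {D L K : ℕ} (hD : 2 ≤ D) (P : AgeMDP.Problem D L K) (hμ : (P.μ : ℝ) < 1) :
    -- the decision problem is feasible if and only if the linear program is, and then the
    -- minimum of the linear program is attained
    (∀ ν : PMF (AgeMDP.Age D),
      (∃ p : AgeMDP.Policy D L, P.Feasible ν p) ↔ ∃ y, P.LPFeasible y) ∧
    ((∃ y, P.LPFeasible y) → ∃ y, P.LPOptimal y) ∧
    -- every stationary policy has long-run occupation measures `y`, independent of the initial
    -- law, through which the decision problem becomes the linear program
    (∀ f : AgeMDP.StationaryPolicy D L, ∃ y : AgeMDP.Age D → AgeMDP.Action L → ℝ,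
      ∀ ν : PMF (AgeMDP.Age D),
        (∀ a l, Tendsto (AgeMDP.occupation P.μ ν f.toPolicy a l) atTop (𝓝 (y a l))) ∧
        (∀ g : AgeMDP.Age D → AgeMDP.Action L → ℝ,
          Tendsto (AgeMDP.average P.μ ν f.toPolicy g) atTop (𝓝 (∑ a, ∑ l, y a l * g a l))) ∧
        P.objective ν f.toPolicy = P.lpObjective y ∧
        (P.Feasible ν f.toPolicy ↔ P.LPFeasible y) ∧
        (P.Optimal ν f.toPolicy ↔ P.LPOptimal y)) ∧
    -- every feasible `y`, with any fixed choice `g` at the ages of zero mass, yields a stationary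
    -- policy with occupation measures `y`, which is optimal if `y` is
    (∀ (y : AgeMDP.Age D → AgeMDP.Action L → ℝ) (g : AgeMDP.StationaryPolicy D L),
      P.LPFeasible y →
      ∃ f : AgeMDP.StationaryPolicy D L, AgeMDP.IsPolicyOf y g f ∧
        ∀ ν : PMF (AgeMDP.Age D),
          (∀ a l, Tendsto (AgeMDP.occupation P.μ ν f.toPolicy a l) atTop (𝓝 (y a l))) ∧
          P.Feasible ν f.toPolicy ∧
          P.objective ν f.toPolicy = P.lpObjective y ∧
          (P.LPOptimal y → P.Optimal ν f.toPolicy)) := by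
  refine ⟨fun ν => ⟨fun ⟨p, hp⟩ => ?_, fun ⟨y, hy⟩ => ?_⟩, AgeMDP.Problem.exists_lpOptimal,
    fun f => ?_, fun y g hy => ?_⟩
  · obtain ⟨y, hy, -⟩ := hp.exists_lpFeasible hD
    exact ⟨y, hy⟩
  · obtain ⟨f, -, hf⟩ := hy.exists_policy hD hμ fun _ => PMF.pure 0
    exact ⟨_, (AgeMDP.Problem.feasible_iff hD (hf ν)).2 hy⟩
  · obtain ⟨y, hy⟩ := AgeMDP.exists_limit_occupation P.μ hD hμ f
    exact ⟨y, fun ν => ⟨hy ν, AgeMDP.tendsto_average (hy ν),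
      AgeMDP.Problem.objective_eq (hy ν), AgeMDP.Problem.feasible_iff hD (hy ν),
      AgeMDP.Problem.optimal_iff hD hμ (hy ν)⟩⟩
  · obtain ⟨f, hfg, hf⟩ := hy.exists_policy hD hμ g
    exact ⟨f, hfg, fun ν => ⟨hf ν, (AgeMDP.Problem.feasible_iff hD (hf ν)).2 hy,
      AgeMDP.Problem.objective_eq (hf ν), (AgeMDP.Problem.optimal_iff hD hμ (hf ν)).2⟩⟩
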